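/- Let $L$ be a completely regular frame, let $\mathcal{R}L$ be the commutative ring of real-valued continuous functions on $L$ (frame homomorphisms from the frame of reals $\mathcal{L}(\mathbb{R})$ to $L$), and for $\varphi\in\mathcal{R}L$ let $$\operatorname{coz}\varphi=\bigvee\{\varphi(p,0)\vee\varphi(0,q)\mid p,q\in\mathbb{Q}\},\qquad \operatorname{Coz}L=\{\operatorname{coz}\varphi\mid\varphi\in\mathcal{R}L\}.$$ The frame $L$ is a $P_F$-frame if, whenever $a,b\in\operatorname{Coz}L$ and $a\wedge b=0$, at least one of $a,b$ is complemented in $L$. An ideal $I$ of $\mathcal{R}L$ is a $z$-ideal if $\varphi\in I$ and $\operatorname{coz}\alpha=\operatorname{coz}\varphi$ imply $\alpha\in I$; it is an $r$-ideal if $\alpha\varphi\in I$ with $\varphi$ a regular element (non-zero-divisor) of $\mathcal{R}L$ implies $\alpha\in I$; it is a $z_r$-ideal if it is both a $z$-ideal and an $r$-ideal. The following statements are equivalent. 1. The sum of every two $z_r$-ideals of $\mathcal{R}L$ is a $z_r$-ideal or all of $\mathcal{R}L$, and of any two ideals of $\mathcal{R}L$ whose sum is a proper $z_r$-ideal, at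 least one is a $z_r$-ideal. 2. $L$ is a $P_F$-frame. 3. Of any two ideals of $\mathcal{R}L$ whose intersection is a $z_r$-ideal, at least one is a $z_r$-ideal. -/

import Mathlib

open TopologicalSpace

noncomputable section

namespace PFFrame

universe u v w

/-! ### Frame homomorphisms out of frames of open sets -/

section Pairing

variable {L : Type u} [Order.Frame L]

/-- The open rectangle `V × W`. -/
def box {X : Type v} {Y : Type w} [TopologicalSpace X] [TopologicalSpace Y]
    (V : Opens X) (W : Opens Y) : Opens (X × Y) :=
  ⟨(V : Set X) ×ˢ (W : Set Y), V.isOpen.prod W.isOpen⟩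

theorem box_mono {X : Type v} {Y : Type w} [TopologicalSpace X] [TopologicalSpace Y]
    {V V' : Opens X} {W W' : Opens Y} (hV : V ≤ V') (hW : W ≤ W') : box V W ≤ box V' W' :=
  Set.prod_mono hV hW

theorem eq_sSup_box {X : Type v} {Y : Type w} [TopologicalSpace X] [TopologicalSpace Y]
    (U : Opens (X × Y)) :
    U = sSup {B | B ≤ U ∧ ∃ V W, B = box V W} := by
  apply le_antisymm
  · rintro ⟨x, y⟩ hxy
    obtain ⟨A, B, hA, hB, hx, hy, hAB⟩ := isOpen_prod_iff.1 U.isOpen x y hxy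
    exact Opens.mem_sSup.2 ⟨box ⟨A, hA⟩ ⟨B, hB⟩, ⟨hAB, _, _, rfl⟩, ⟨hx, hy⟩⟩
  · exact sSup_le fun B hB => hB.1

/-- Two frame homomorphisms on the open sets of a product agree if they agree on rectangles. -/
theorem hom_ext_box {X : Type v} {Y : Type w} [TopologicalSpace X] [TopologicalSpace Y]
    {f g : FrameHom (Opens (X × Y)) L} (h : ∀ V W, f (box V W) = g (box V W)) : f = g := by
  ext U
  rw [eq_sSup_box U, map_sSup, map_sSup]
  congr 1
  apply Set.image_congr
  rintro B ⟨-, V, W, rfl⟩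
  exact h V W

/-- The underlying map of the pairing of `α` and `β`:
`U ↦ ⋁ {α V ∧ β W | V × W ⊆ U}`. -/
def pairFun {X : Type v} {Y : Type w} [TopologicalSpace X] [TopologicalSpace Y]
    (α : FrameHom (Opens X) L) (β : FrameHom (Opens Y) L) (U : Opens (X × Y)) : L :=
  ⨆ (V : Opens X) (W : Opens Y) (_ : box V W ≤ U), α V ⊓ β W

theorem le_pairFun {X : Type v} {Y : Type w} [TopologicalSpace X] [TopologicalSpace Y]
    (α : FrameHom (Opens X) L) (β : FrameHom (Opens Y) L) {U : Opens (X × Y)}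
    {V : Opens X} {W : Opens Y} (h : box V W ≤ U) : α V ⊓ β W ≤ pairFun α β U :=
  le_iSup_of_le V (le_iSup_of_le W (le_iSup_of_le h le_rfl))

theorem pairFun_mono {X : Type v} {Y : Type w} [TopologicalSpace X] [TopologicalSpace Y]
    (α : FrameHom (Opens X) L) (β : FrameHom (Opens Y) L) : Monotone (pairFun α β) :=
  fun _ _ h => iSup_le fun _ => iSup_le fun _ => iSup_le fun h' => le_pairFun α β (h'.trans h)

theorem pairFun_inf {X : Type v} {Y : Type w} [TopologicalSpace X] [TopologicalSpace Y]
    (α : FrameHom (Opens X) L) (β : FrameHom (Opens Y) L) (U U' : Opens (X × Y)) :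
    pairFun α β (U ⊓ U') = pairFun α β U ⊓ pairFun α β U' := by
  apply le_antisymm
  · exact le_inf (pairFun_mono α β inf_le_left) (pairFun_mono α β inf_le_right)
  · conv_lhs => unfold pairFun
    simp only [iSup_inf_eq, inf_iSup_eq]
    refine iSup_le fun V => iSup_le fun W => iSup_le fun h => iSup_le fun V' => iSup_le fun W' =>
      iSup_le fun h' => ?_
    rw [inf_inf_inf_comm, ← map_inf, ← map_inf]
    exact le_pairFun α β (le_inf ((box_mono inf_le_left inf_le_left).trans h')
      ((box_mono inf_le_right inf_le_right).trans h))

theorem pairFun_sSup {X : Type v} {Y : Type w} [TopologicalSpace X] [TopologicalSpace Y]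
    [LocallyCompactSpace Y]
    (α : FrameHom (Opens X) L) (β : FrameHom (Opens Y) L) (S : Set (Opens (X × Y))) :
    pairFun α β (sSup S) = sSup (pairFun α β '' S) := by
  apply le_antisymm
  swap
  · refine sSup_le ?_
    rintro _ ⟨U, hU, rfl⟩
    exact pairFun_mono α β (le_sSup hU)
  refine iSup_le fun V => iSup_le fun W => iSup_le fun h => ?_
  set T := sSup (pairFun α β '' S) with hT
  -- `W` is the union of the open sets contained in a compact subset of `W`
  have hW : W = sSup {K : Opens Y | ∃ C : Set Y, IsCompact C ∧ (K : Set Y) ⊆ C ∧ C ⊆ W} := by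
    apply le_antisymm
    · intro y hy
      obtain ⟨C, hC, hyC, hCW⟩ := exists_compact_subset W.isOpen hy
      exact Opens.mem_sSup.2 ⟨⟨interior C, isOpen_interior⟩, ⟨C, hC, interior_subset, hCW⟩, hyC⟩
    · refine sSup_le ?_
      rintro K ⟨C, -, h1, h2⟩
      exact h1.trans h2
  rw [hW, map_sSup, inf_sSup_eq]
  refine iSup₂_le ?_
  rintro _ ⟨K, ⟨C, hC, hKC, hCW⟩, rfl⟩
  have key : ∀ x ∈ V, ∃ A : Opens X, x ∈ A ∧ α A ⊓ β K ≤ T := by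
    intro x hx
    have loc : ∀ y ∈ C, ∃ A : Opens X, ∃ B : Opens Y, x ∈ A ∧ y ∈ B ∧ α A ⊓ β B ≤ T := by
      intro y hy
      have hxy : (x, y) ∈ sSup S := h ⟨hx, hCW hy⟩
      obtain ⟨U, hU, hxyU⟩ := Opens.mem_sSup.1 hxy
      obtain ⟨A, B, hA, hB, hxA, hyB, hAB⟩ := isOpen_prod_iff.1 U.isOpen x y hxyU
      exact ⟨⟨A, hA⟩, ⟨B, hB⟩, hxA, hyB,
        (le_pairFun α β (V := ⟨A, hA⟩) (W := ⟨B, hB⟩) hAB).trans (le_sSup ⟨U, hU, rfl⟩)⟩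
    have : ∃ A : Opens X, ∃ B : Opens Y, x ∈ A ∧ C ⊆ B ∧ α A ⊓ β B ≤ T := by
      refine hC.induction_on (p := fun D => ∃ A : Opens X, ∃ B : Opens Y,
        x ∈ A ∧ D ⊆ B ∧ α A ⊓ β B ≤ T) ?_ ?_ ?_ ?_
      · exact ⟨⊤, ⊥, trivial, Set.empty_subset _, by simp⟩
      · rintro s t hst ⟨A, B, hA, hB, hAB⟩
        exact ⟨A, B, hA, hst.trans hB, hAB⟩
      · rintro s t ⟨A, B, hA, hB, hAB⟩ ⟨A', B', hA', hB', hAB'⟩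
        refine ⟨A ⊓ A', B ⊔ B', ⟨hA, hA'⟩, ?_, ?_⟩
        · rw [Opens.coe_sup]
          exact Set.union_subset_union hB hB'
        · rw [map_sup, map_inf, inf_sup_left]
          exact sup_le ((inf_le_inf_right _ inf_le_left).trans hAB)
            ((inf_le_inf_right _ inf_le_right).trans hAB')
      · intro y hy
        obtain ⟨A, B, hA, hB, hAB⟩ := loc y hy
        exact ⟨B, mem_nhdsWithin_of_mem_nhds (B.isOpen.mem_nhds hB), A, B, hA, subset_rfl, hAB⟩
    obtain ⟨A, B, hA, hB, hAB⟩ := this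
    exact ⟨A, hA, (inf_le_inf_left _ (OrderHomClass.mono β (hKC.trans hB))).trans hAB⟩
  have hV : V ≤ sSup {A : Opens X | α A ⊓ β K ≤ T} := by
    intro x hx
    obtain ⟨A, hxA, hA⟩ := key x hx
    exact Opens.mem_sSup.2 ⟨A, hA, hxA⟩
  refine (inf_le_inf_right _ (OrderHomClass.mono α hV)).trans ?_
  rw [map_sSup, sSup_inf_eq]
  refine iSup₂_le ?_
  rintro _ ⟨A, hA, rfl⟩
  exact hA

/-- The pairing of two frame homomorphisms: for locally compact `Y` the frame of open sets of
`X × Y` is the coproduct of the frames of open sets of `X` and of `Y`. -/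
def pair {X : Type v} {Y : Type w} [TopologicalSpace X] [TopologicalSpace Y]
    [LocallyCompactSpace Y] (α : FrameHom (Opens X) L) (β : FrameHom (Opens Y) L) :
    FrameHom (Opens (X × Y)) L where
  toFun := pairFun α β
  map_inf' := pairFun_inf α β
  map_top' := by
    rw [eq_top_iff]
    refine le_trans ?_ (le_pairFun α β (V := ⊤) (W := ⊤) le_top)
    simp
  map_sSup' := pairFun_sSup α β

theorem pair_box {X : Type v} {Y : Type w} [TopologicalSpace X] [TopologicalSpace Y]
    [LocallyCompactSpace Y] (α : FrameHom (Opens X) L) (β : FrameHom (Opens Y) L)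
    (V : Opens X) (W : Opens Y) : pair α β (box V W) = α V ⊓ β W := by
  apply le_antisymm
  · refine iSup_le fun V' => iSup_le fun W' => iSup_le fun h => ?_
    by_cases hV : (V' : Set X) = ∅
    · have : V' = ⊥ := Opens.ext hV
      subst this
      simp
    by_cases hW : (W' : Set Y) = ∅
    · have : W' = ⊥ := Opens.ext hW
      subst this
      simp
    obtain ⟨x, hx⟩ := Set.nonempty_iff_ne_empty.2 hV
    obtain ⟨y, hy⟩ := Set.nonempty_iff_ne_empty.2 hW
    refine inf_le_inf (OrderHomClass.mono α ?_) (OrderHomClass.mono β ?_)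
    · intro x' hx'
      exact (h (show (x', y) ∈ box V' W' from ⟨hx', hy⟩)).1
    · intro y' hy'
      exact (h (show (x, y') ∈ box V' W' from ⟨hx, hy'⟩)).2
  · exact le_pairFun α β le_rfl

/-- Composition of a frame homomorphism with the inverse image map of a continuous function. -/
def pull {X : Type v} {Y : Type w} [TopologicalSpace X] [TopologicalSpace Y]
    (δ : FrameHom (Opens X) L) (f : C(X, Y)) : FrameHom (Opens Y) L :=
  δ.comp (Opens.comap f)

theorem pull_apply {X : Type v} {Y : Type w} [TopologicalSpace X] [TopologicalSpace Y]
    (δ : FrameHom (Opens X) L) (f : C(X, Y)) (U : Opens Y) :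
    pull δ f U = δ (Opens.comap f U) := rfl

theorem pull_pull {X Y Z : Type*} [TopologicalSpace X] [TopologicalSpace Y] [TopologicalSpace Z]
    (δ : FrameHom (Opens X) L) (f : C(X, Y)) (g : C(Y, Z)) :
    pull (pull δ f) g = pull δ (g.comp f) := rfl

theorem pair_pull {X Y Z : Type*} [TopologicalSpace X] [TopologicalSpace Y] [TopologicalSpace Z]
    [LocallyCompactSpace Y] (δ : FrameHom (Opens Z) L) (f : C(Z, X)) (g : C(Z, Y)) :
    pair (pull δ f) (pull δ g) = pull δ (f.prodMk g) := by
  apply hom_ext_box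
  intro V W
  rw [pair_box, pull_apply, pull_apply, pull_apply, ← map_inf]
  rfl

theorem pull_pair_fst {X Y : Type*} [TopologicalSpace X] [TopologicalSpace Y]
    [LocallyCompactSpace Y] (α : FrameHom (Opens X) L) (β : FrameHom (Opens Y) L) :
    pull (pair α β) ContinuousMap.fst = α := by
  ext V
  have : Opens.comap (ContinuousMap.fst : C(X × Y, X)) V = box V ⊤ := by
    ext x; simp [box]
  rw [pull_apply, this, pair_box, map_top, inf_top_eq]

theorem pull_pair_snd {X Y : Type*} [TopologicalSpace X] [TopologicalSpace Y]
    [LocallyCompactSpace Y] (α : FrameHom (Opens X) L) (β : FrameHom (Opens Y) L) :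
    pull (pair α β) ContinuousMap.snd = β := by
  ext V
  have : Opens.comap (ContinuousMap.snd : C(X × Y, Y)) V = box ⊤ V := by
    ext x; simp [box]
  rw [pull_apply, this, pair_box, map_top, top_inf_eq]

end Pairing

/-! ### The ring of real-valued continuous functions on a frame -/

/-- The set `ℛL` of real-valued continuous functions on `L`, that is, of frame homomorphisms
from the frame of reals to `L`. The frame of reals is realised as the frame of open subsets of
`ℝ`, with the interval `(p, q)` as the generator `(p, q)`; see `frameOfReals_universal`. -/
def RL (L : Type u) [Order.Frame L] : Type u := FrameHom (Opens ℝ) L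

/-- The open interval `(p, q)` with rational endpoints, as a generator of the frame of reals. -/
def ratIoo (p q : ℚ) : Opens ℝ := ⟨Set.Ioo (p : ℝ) (q : ℝ), isOpen_Ioo⟩

/-- The frame of open subsets of `ℝ` is the frame presented by generators `(p, q)`,
`p, q ∈ ℚ`, and the defining relations of the frame of reals:
(R1) `(p, q) ∧ (r, s) = (p ∨ r, q ∧ s)`, (R2) `(p, q) ∨ (r, s) = (p, s)` if `p ≤ r < q ≤ s`,
(R3) `(p, q) = ⋁ {(r, s) | p < r < s < q}`, (R4) `1 = ⋁ {(p, q) | p, q ∈ ℚ}`. -/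
theorem frameOfReals_universal {L : Type u} [Order.Frame L] (f : ℚ → ℚ → L)
    (R1 : ∀ p q r s, f p q ⊓ f r s = f (p ⊔ r) (q ⊓ s))
    (R2 : ∀ p q r s, p ≤ r → r < q → q ≤ s → f p q ⊔ f r s = f p s)
    (R3 : ∀ p q, f p q = ⨆ (r : ℚ) (s : ℚ) (_ : p < r ∧ r < s ∧ s < q), f r s)
    (R4 : (⊤ : L) = ⨆ (p : ℚ) (q : ℚ), f p q) :
    ∃! φ : FrameHom (Opens ℝ) L, ∀ p q, φ (ratIoo p q) = f p q := by
  have bot : ∀ p q, q ≤ p → f p q = ⊥ := by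
    intro p q h
    rw [R3, eq_bot_iff]
    refine iSup_le fun r => iSup_le fun s => iSup_le fun h' => ?_
    exact absurd (h'.1.trans (h'.2.1.trans h'.2.2)) (not_lt.2 h)
  have mono : ∀ p q r s, r ≤ p → q ≤ s → f p q ≤ f r s := by
    intro p q r s h1 h2
    have := R1 p q r s
    rw [sup_eq_left.2 h1, inf_eq_left.2 h2] at this
    exact inf_eq_left.1 this
  have basis : ∀ U : Opens ℝ, U = sSup {B | B ≤ U ∧ ∃ p q, B = ratIoo p q} := by
    intro U
    apply le_antisymm
    · intro x hx
      obtain ⟨a, b, hab, hU⟩ := mem_nhds_iff_exists_Ioo_subset.1 (U.isOpen.mem_nhds hx)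
      obtain ⟨p, hp1, hp2⟩ := exists_rat_btwn hab.1
      obtain ⟨q, hq1, hq2⟩ := exists_rat_btwn hab.2
      exact Opens.mem_sSup.2 ⟨ratIoo p q,
        ⟨(Set.Ioo_subset_Ioo hp1.le hq2.le).trans hU, p, q, rfl⟩, ⟨hp2, hq1⟩⟩
    · exact sSup_le fun B hB => hB.1
  let F : Opens ℝ → L := fun U => ⨆ (p : ℚ) (q : ℚ) (_ : ratIoo p q ≤ U), f p q
  have leF : ∀ {p q : ℚ} {U : Opens ℝ}, ratIoo p q ≤ U → f p q ≤ F U := fun {p q U} h =>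
    le_iSup_of_le p (le_iSup_of_le q (le_iSup_of_le h le_rfl))
  have Fmono : Monotone F := fun U U' h =>
    iSup_le fun p => iSup_le fun q => iSup_le fun h' => leF (h'.trans h)
  have Ftop : F ⊤ = ⊤ := by
    rw [eq_top_iff, R4]
    exact iSup_le fun p => iSup_le fun q => leF le_top
  have Finf : ∀ U U', F (U ⊓ U') = F U ⊓ F U' := by
    intro U U'
    apply le_antisymm
    · exact le_inf (Fmono inf_le_left) (Fmono inf_le_right)
    · simp only [F, iSup_inf_eq, inf_iSup_eq]
      refine iSup_le fun p => iSup_le fun q => iSup_le fun h => iSup_le fun r =>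
        iSup_le fun s => iSup_le fun h' => ?_
      rw [inf_comm, R1]
      apply leF
      rintro x ⟨hx1, hx2⟩
      change ((p ⊔ r : ℚ) : ℝ) < x at hx1
      change x < ((q ⊓ s : ℚ) : ℝ) at hx2
      rw [Rat.cast_max, max_lt_iff] at hx1
      rw [Rat.cast_min, lt_min_iff] at hx2
      exact ⟨h' ⟨hx1.2, hx2.2⟩, h ⟨hx1.1, hx2.1⟩⟩
  have FsSup : ∀ S, F (sSup S) = sSup (F '' S) := by
    intro S
    apply le_antisymm
    swap
    · refine sSup_le ?_
      rintro _ ⟨U, hU, rfl⟩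
      exact Fmono (le_sSup hU)
    refine iSup_le fun p' => iSup_le fun q' => iSup_le fun h => ?_
    rw [R3]
    refine iSup_le fun p => iSup_le fun q => iSup_le fun hpq => ?_
    set T := sSup (F '' S)
    have loc : ∀ x : ℝ, (p : ℝ) ≤ x → x ≤ q → ∃ a b : ℚ, (a : ℝ) < x ∧ x < b ∧ f a b ≤ T := by
      intro x h1 h2
      have hx : x ∈ sSup S := h ⟨lt_of_lt_of_le (Rat.cast_lt.2 hpq.1) h1,
        lt_of_le_of_lt h2 (Rat.cast_lt.2 hpq.2.2)⟩
      obtain ⟨U, hU, hxU⟩ := Opens.mem_sSup.1 hx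
      rw [basis U] at hxU
      obtain ⟨B, ⟨hB, a, b, rfl⟩, hxB⟩ := Opens.mem_sSup.1 hxU
      exact ⟨a, b, hxB.1, hxB.2, (leF hB).trans (le_sSup ⟨U, hU, rfl⟩)⟩
    let E : Set ℝ := {x | ∃ b : ℚ, x = b ∧ p ≤ b ∧ b ≤ q ∧ f p b ≤ T}
    have hpE : (p : ℝ) ∈ E := ⟨p, rfl, le_rfl, hpq.2.1.le, by rw [bot p p le_rfl]; exact bot_le⟩
    have hbd : BddAbove E := ⟨q, by rintro _ ⟨b, rfl, -, hb, -⟩; exact_mod_cast hb⟩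
    obtain ⟨a, b, ha, hb, hab⟩ := loc (sSup E) (le_csSup hbd hpE)
      (csSup_le ⟨_, hpE⟩ (by rintro _ ⟨b, rfl, -, hb, -⟩; exact_mod_cast hb))
    obtain ⟨_, ⟨s, rfl, hps, hsq, hs⟩, has⟩ := exists_lt_of_lt_csSup ⟨_, hpE⟩ ha
    have hsb : (s : ℝ) < b := lt_of_le_of_lt (le_csSup hbd ⟨s, rfl, hps, hsq, hs⟩) hb
    have has' : a < s := by exact_mod_cast has
    have hsb' : s < b := by exact_mod_cast hsb
    have hpb : f p b ≤ T := by
      rcases le_total p a with hpa | hap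
      · rw [← R2 p s a b hpa has' hsb'.le]
        exact sup_le hs hab
      · exact (mono p b a b hap le_rfl).trans hab
    rcases le_total b q with hbq | hqb
    · exact absurd (le_csSup hbd ⟨b, rfl, hps.trans hsb'.le, hbq, hpb⟩) (not_le.2 hb)
    · exact (mono p q p b le_rfl hqb).trans hpb
  refine ⟨{ toFun := F, map_inf' := Finf, map_top' := Ftop, map_sSup' := FsSup }, ?_, ?_⟩
  · intro p q
    change F (ratIoo p q) = f p q
    apply le_antisymm
    · refine iSup_le fun r => iSup_le fun s => iSup_le fun h => ?_
      rcases le_or_gt s r with hsr | hrs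
      · rw [bot r s hsr]; exact bot_le
      · have := (Set.Ioo_subset_Ioo_iff (by exact_mod_cast hrs : (r : ℝ) < s)).1 h
        exact mono r s p q (by exact_mod_cast this.1) (by exact_mod_cast this.2)
    · exact leF le_rfl
  · intro ψ hψ
    ext U
    change ψ U = F U
    conv_lhs => rw [basis U, map_sSup]
    apply le_antisymm
    · refine sSup_le ?_
      rintro _ ⟨_, ⟨hB, p, q, rfl⟩, rfl⟩
      rw [hψ]
      exact leF hB
    · refine iSup_le fun p => iSup_le fun q => iSup_le fun h => ?_
      rw [← hψ]
      exact le_sSup ⟨_, ⟨h, p, q, rfl⟩, rfl⟩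

section RingStructure

variable {L : Type u} [Order.Frame L]

instance : FunLike (RL L) (Opens ℝ) L := inferInstanceAs (FunLike (FrameHom (Opens ℝ) L) _ _)

instance : FrameHomClass (RL L) (Opens ℝ) L :=
  inferInstanceAs (FrameHomClass (FrameHom (Opens ℝ) L) _ _)

/-- The constant function with value `r`: it sends `U` to `1` if `r ∈ U` and to `0` otherwise. -/
def RL.const (r : ℝ) : RL L where
  toFun U := ⨆ (_ : r ∈ U), ⊤
  map_inf' U V := by
    by_cases h1 : r ∈ U <;> by_cases h2 : r ∈ V <;> simp [h1, h2]
  map_top' := by simp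
  map_sSup' S := by
    by_cases h : ∃ U ∈ S, r ∈ U
    · obtain ⟨U, hU, hr⟩ := h
      have h' : r ∈ sSup S := Opens.mem_sSup.2 ⟨U, hU, hr⟩
      rw [iSup_pos h']
      refine (top_le_iff.1 (le_sSup_of_le (Set.mem_image_of_mem _ hU) ?_)).symm
      simp only [iSup_pos hr, le_refl]
    · have h' : r ∉ sSup S := fun hr => h (by simpa using Opens.mem_sSup.1 hr)
      rw [iSup_neg h', eq_comm, eq_bot_iff]
      refine sSup_le ?_
      rintro _ ⟨U, hU, rfl⟩
      exact iSup_le fun hr => absurd ⟨U, hU, hr⟩ h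

instance : Zero (RL L) := ⟨RL.const 0⟩

instance : One (RL L) := ⟨RL.const 1⟩

/-- `(α + β)(U) = ⋁ {α(V) ∧ β(W) | V + W ⊆ U}`. -/
instance : Add (RL L) := ⟨fun α β => pull (pair α β) ⟨fun x => x.1 + x.2, by fun_prop⟩⟩

/-- `(α β)(U) = ⋁ {α(V) ∧ β(W) | V W ⊆ U}`. -/
instance : Mul (RL L) := ⟨fun α β => pull (pair α β) ⟨fun x => x.1 * x.2, by fun_prop⟩⟩

/-- `(-α)(U) = α(-U)`. -/
instance : Neg (RL L) := ⟨fun α => pull (X := ℝ) α ⟨fun x => -x, by fun_prop⟩⟩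

/-- The function `f` of the "continuous map" `δ` with values in `Z`. -/
def RL.of {Z : Type} [TopologicalSpace Z] (δ : FrameHom (Opens Z) L) (f : C(Z, ℝ)) : RL L :=
  pull δ f

variable {Z : Type} [TopologicalSpace Z] (δ : FrameHom (Opens Z) L)

theorem RL.of_add (f g : C(Z, ℝ)) : RL.of δ f + RL.of δ g = RL.of δ (f + g) :=
  (congrArg (fun ε => pull ε _) (pair_pull δ f g)).trans rfl

theorem RL.of_mul (f g : C(Z, ℝ)) : RL.of δ f * RL.of δ g = RL.of δ (f * g) :=
  (congrArg (fun ε => pull ε _) (pair_pull δ f g)).trans rfl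

theorem RL.of_neg (f : C(Z, ℝ)) : -RL.of δ f = RL.of δ (-f) := rfl

theorem RL.const_eq_of (r : ℝ) : (RL.const r : RL L) = RL.of δ (ContinuousMap.const Z r) := by
  refine DFunLike.ext (F := FrameHom (Opens ℝ) L) _ _ fun U => ?_
  change (⨆ (_ : r ∈ U), ⊤) = δ (Opens.comap (ContinuousMap.const Z r) U)
  by_cases h : r ∈ U
  · have : Opens.comap (ContinuousMap.const Z r) U = ⊤ := by ext; simpa using h
    rw [this, map_top, iSup_pos h]
  · have : Opens.comap (ContinuousMap.const Z r) U = ⊥ := by ext; simpa using h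
    rw [this, map_bot, iSup_neg h]

theorem RL.zero_eq_of : (0 : RL L) = RL.of δ 0 := RL.const_eq_of δ 0

theorem RL.one_eq_of : (1 : RL L) = RL.of δ 1 := RL.const_eq_of δ 1

/-- Any three elements of `ℛL` are functions of one "continuous map" with values in `ℝ³`. -/
theorem RL.exists_of (α β γ : RL L) :
    ∃ (δ : FrameHom (Opens (ℝ × (ℝ × ℝ))) L) (f g h : C(ℝ × (ℝ × ℝ), ℝ)),
      α = RL.of δ f ∧ β = RL.of δ g ∧ γ = RL.of δ h := by
  refine ⟨pair α (pair β γ), ContinuousMap.fst, ContinuousMap.fst.comp ContinuousMap.snd,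
    ContinuousMap.snd.comp ContinuousMap.snd, (pull_pair_fst _ _).symm, ?_, ?_⟩
  · exact ((congrArg (fun ε => pull ε ContinuousMap.fst) (pull_pair_snd α (pair β γ))).trans
      (pull_pair_fst β γ)).symm
  · exact ((congrArg (fun ε => pull ε ContinuousMap.snd) (pull_pair_snd α (pair β γ))).trans
      (pull_pair_snd β γ)).symm

instance : CommRing (RL L) where
  add_assoc α β γ := by
    obtain ⟨δ, f, g, h, rfl, rfl, rfl⟩ := RL.exists_of α β γ
    simp only [RL.of_add, add_assoc]
  zero_add α := by
    obtain ⟨δ, f, g, h, rfl, -, -⟩ := RL.exists_of α α α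
    rw [RL.zero_eq_of δ, RL.of_add, zero_add]
  add_zero α := by
    obtain ⟨δ, f, g, h, rfl, -, -⟩ := RL.exists_of α α α
    rw [RL.zero_eq_of δ, RL.of_add, add_zero]
  add_comm α β := by
    obtain ⟨δ, f, g, h, rfl, rfl, -⟩ := RL.exists_of α β β
    rw [RL.of_add, RL.of_add, add_comm]
  left_distrib α β γ := by
    obtain ⟨δ, f, g, h, rfl, rfl, rfl⟩ := RL.exists_of α β γ
    simp only [RL.of_add, RL.of_mul, mul_add]
  right_distrib α β γ := by
    obtain ⟨δ, f, g, h, rfl, rfl, rfl⟩ := RL.exists_of α β γ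
    simp only [RL.of_add, RL.of_mul, add_mul]
  zero_mul α := by
    obtain ⟨δ, f, g, h, rfl, -, -⟩ := RL.exists_of α α α
    rw [RL.zero_eq_of δ, RL.of_mul, zero_mul]
  mul_zero α := by
    obtain ⟨δ, f, g, h, rfl, -, -⟩ := RL.exists_of α α α
    rw [RL.zero_eq_of δ, RL.of_mul, mul_zero]
  mul_assoc α β γ := by
    obtain ⟨δ, f, g, h, rfl, rfl, rfl⟩ := RL.exists_of α β γ
    simp only [RL.of_mul, mul_assoc]
  one_mul α := by
    obtain ⟨δ, f, g, h, rfl, -, -⟩ := RL.exists_of α α α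
    rw [RL.one_eq_of δ, RL.of_mul, one_mul]
  mul_one α := by
    obtain ⟨δ, f, g, h, rfl, -, -⟩ := RL.exists_of α α α
    rw [RL.one_eq_of δ, RL.of_mul, mul_one]
  mul_comm α β := by
    obtain ⟨δ, f, g, h, rfl, rfl, -⟩ := RL.exists_of α β β
    rw [RL.of_mul, RL.of_mul, mul_comm]
  neg_add_cancel α := by
    obtain ⟨δ, f, g, h, rfl, -, -⟩ := RL.exists_of α α α
    rw [RL.of_neg, RL.of_add, RL.zero_eq_of δ, neg_add_cancel]
  nsmul := nsmulRec
  zsmul := zsmulRec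

end RingStructure

/-! ### Completely regular frames, cozero elements and `P_F`-frames -/

section Frames

variable {L : Type u} [Order.Frame L]

/-- `a ≺ b`: there is a separating element `t` with `a ∧ t = 0` and `t ∨ b = 1`. -/
def RatherBelow (a b : L) : Prop := ∃ t : L, a ⊓ t = ⊥ ∧ t ⊔ b = ⊤

/-- `a ≺≺ b`: there are `c q`, for rational `q` in `[0, 1]`, with `c 0 = a`, `c 1 = b` and
`c r ≺ c s` whenever `r < s`. -/
def CompletelyBelow (a b : L) : Prop :=
  ∃ c : Set.Icc (0 : ℚ) 1 → L, c 0 = a ∧ c 1 = b ∧ ∀ r s, r < s → RatherBelow (c r) (c s)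

variable (L) in
/-- The frame `L` is completely regular. -/
def IsCompletelyRegular : Prop := ∀ a : L, a = sSup {x | CompletelyBelow x a}

/-- The cozero map `coz φ = ⋁ {φ(p, 0) ∨ φ(0, q) | p, q ∈ ℚ}`. -/
def coz (φ : RL L) : L :=
  ⨆ (p : ℚ) (q : ℚ), φ (ratIoo p 0) ⊔ φ (ratIoo 0 q)

variable (L) in
/-- The set `Coz L` of cozero elements of `L`. -/
def CozPart : Set L := Set.range (coz : RL L → L)

variable (L) in
/-- `L` is a `P_F`-frame: of any two disjoint cozero elements at least one is complemented. -/
def IsPFFrame : Prop :=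
  ∀ a ∈ CozPart L, ∀ b ∈ CozPart L, a ⊓ b = ⊥ → IsComplemented a ∨ IsComplemented b

/-- `z`-ideals of `ℛL`. -/
def IsZIdeal (I : Ideal (RL L)) : Prop :=
  ∀ α φ : RL L, φ ∈ I → coz α = coz φ → α ∈ I

/-- `r`-ideals of `ℛL`; regular elements are the non-zero-divisors. -/
def IsRIdeal (I : Ideal (RL L)) : Prop :=
  ∀ α φ : RL L, IsRegular φ → α * φ ∈ I → α ∈ I

/-- `z_r`-ideals of `ℛL`. -/
def IsZrIdeal (I : Ideal (RL L)) : Prop := IsZIdeal I ∧ IsRIdeal I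

end Frames

end PFFrame

end

/-! The topology is first turned into algebra: `coz φ` is complemented exactly when `φ` is von
Neumann regular (`isComplemented_coz_iff`). So `L` is a `P_F`-frame iff, of any two functions with
product zero, one is von Neumann regular.

Let `L` be a `P_F`-frame. For any `α`, `β`, the cube of `α` is a multiple of `β` where `α² ≤ β²`,
and the cube of `β` is a multiple of `α` where `β² ≤ α²`. The two error terms live on disjoint
cozero elements, so one of them dies after multiplication by a near idempotent `e`, one for which `1
- e` carries only von Neumann regular functions (`IsPFFrame.exists_cube_eq_mul`). Hence any two
`z`-ideals are comparable up to near idempotents (`IsPFFrame.le_nearIdeal_or`). Being a `z_r`-ideal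
is insensitive to near idempotents (`IsZrIdeal.of_nearIdeal`), because on `1 - e` the `z`- and
`r`-conditions hold for every ideal. This gives statements 1 and 3.

Conversely, let `α`, `β` have product zero with neither von Neumann regular. An ideal generated by
`α` and annihilators of `α` misses the cube root of `α`, so it is not a `z`-ideal
(`not_isZrIdeal_span_sup`). Two such ideals, one for `α` and one for `β`, can be made to intersect
in `0`, and, after shrinking `α` if necessary, others can be made to add up to a proper `z_r`-ideal.
This refutes 3 and 1 respectively. -/

noncomputable section

namespace PFFrame

/-! ### Calculus of cozero elements -/

section CozeroCalculus

variable {L : Type*} [Order.Frame L]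

/-- The punctured line as an open set. -/
def punctured : Opens ℝ := ⟨{0}ᶜ, isOpen_compl_singleton⟩

theorem mem_punctured {x : ℝ} : x ∈ punctured ↔ x ≠ 0 := Iff.rfl

theorem coz_eq_apply_punctured (φ : RL L) : coz φ = φ punctured := by
  have h : punctured = ⨆ (p : ℚ) (q : ℚ), ratIoo p 0 ⊔ ratIoo 0 q := by
    ext x
    simp only [SetLike.mem_coe, mem_punctured, Opens.mem_iSup]
    constructor
    · intro hx
      rcases lt_or_gt_of_ne hx with hx | hx
      · obtain ⟨p, hp⟩ := exists_rat_lt x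
        exact ⟨p, 0, Or.inl ⟨hp, by simpa using hx⟩⟩
      · obtain ⟨q, hq⟩ := exists_rat_gt x
        exact ⟨0, q, Or.inr ⟨by simpa using hx, hq⟩⟩
    · rintro ⟨p, q, h | h⟩
      · have := h.2
        simp only [Rat.cast_zero] at this
        exact this.ne
      · have := h.1
        simp only [Rat.cast_zero] at this
        exact this.ne'
  rw [h, coz]
  simp only [map_iSup, map_sup]

/-- The frame homomorphism underlying an element of `ℛL`. -/
def RL.toHom (φ : RL L) : FrameHom (Opens ℝ) L := φ

theorem RL.of_self (φ : RL L) : RL.of φ.toHom (ContinuousMap.id ℝ) = φ := rfl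

/-- With this, statements about two elements of `ℛL` are checked pointwise on the plane. -/
theorem RL.exists_of_two (α β : RL L) :
    ∃ δ : FrameHom (Opens (ℝ × ℝ)) L,
      α = RL.of δ ContinuousMap.fst ∧ β = RL.of δ ContinuousMap.snd :=
  ⟨pair α β, (pull_pair_fst _ _).symm, (pull_pair_snd _ _).symm⟩

section Of

variable {Z : Type} [TopologicalSpace Z] (δ : FrameHom (Opens Z) L)

theorem coz_of (f : C(Z, ℝ)) : coz (RL.of δ f) = δ (Opens.comap f punctured) :=
  coz_eq_apply_punctured _

theorem coz_of_le {f g : C(Z, ℝ)} (h : ∀ z, f z ≠ 0 → g z ≠ 0) :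
    coz (RL.of δ f) ≤ coz (RL.of δ g) := by
  rw [coz_of, coz_of]
  exact OrderHomClass.mono δ fun z hz => h z hz

theorem coz_of_le_sup {f g h : C(Z, ℝ)} (H : ∀ z, f z ≠ 0 → g z ≠ 0 ∨ h z ≠ 0) :
    coz (RL.of δ f) ≤ coz (RL.of δ g) ⊔ coz (RL.of δ h) := by
  rw [coz_of, coz_of, coz_of, ← map_sup]
  exact OrderHomClass.mono δ fun z hz => H z hz

end Of

theorem coz_mul (α β : RL L) : coz (α * β) = coz α ⊓ coz β := by
  obtain ⟨δ, hα, hβ⟩ := RL.exists_of_two α β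
  rw [hα, hβ, RL.of_mul, coz_of, coz_of, coz_of, ← map_inf]
  congr 1
  ext z
  exact mul_ne_zero_iff

theorem coz_add_le (α β : RL L) : coz (α + β) ≤ coz α ⊔ coz β := by
  obtain ⟨δ, hα, hβ⟩ := RL.exists_of_two α β
  rw [hα, hβ, RL.of_add]
  refine coz_of_le_sup δ fun z hz => ?_
  by_contra! h
  exact hz (by simp [h.1, h.2])

theorem coz_one : coz (1 : RL L) = ⊤ := by
  rw [coz_eq_apply_punctured]
  exact iSup_pos (mem_punctured.2 one_ne_zero)

theorem coz_zero : coz (0 : RL L) = ⊥ := by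
  rw [coz_eq_apply_punctured]
  exact iSup_neg fun h => mem_punctured.1 h rfl

/-- If `φ` kills the punctured line, its value on `U` is forced: an open set containing `0` covers
the line together with the punctured line, and any other lies inside the punctured line. Combined
with `coz_mul`, this makes `ℛL` reduced and turns disjointness into product zero. -/
theorem coz_eq_bot_iff {φ : RL L} : coz φ = ⊥ ↔ φ = 0 := by
  refine ⟨fun h => ?_, fun h => h ▸ coz_zero⟩
  rw [coz_eq_apply_punctured] at h
  refine DFunLike.ext (F := FrameHom (Opens ℝ) L) _ _ fun U => ?_
  change φ U = ⨆ (_ : (0 : ℝ) ∈ U), ⊤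
  by_cases hU : (0 : ℝ) ∈ U
  · have : U ⊔ punctured = ⊤ := by
      ext x
      simp only [Opens.coe_sup, Set.mem_union, SetLike.mem_coe, mem_punctured, Opens.coe_top,
        Set.mem_univ, iff_true]
      by_cases hx : x = 0
      · exact Or.inl (hx ▸ hU)
      · exact Or.inr hx
    have h' := congrArg φ this
    rw [map_sup, h, sup_bot_eq, map_top] at h'
    rw [h', iSup_pos hU]
  · rw [iSup_neg hU, eq_bot_iff, ← h]
    exact OrderHomClass.mono φ fun x hx => mem_punctured.2 (by rintro rfl; exact hU hx)

theorem coz_mul_eq_bot_iff {α β : RL L} : coz α ⊓ coz β = ⊥ ↔ α * β = 0 := by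
  rw [← coz_mul, coz_eq_bot_iff]

theorem coz_pow_three (α : RL L) : coz (α ^ 3) = coz α := by
  rw [pow_three, coz_mul, coz_mul, inf_idem, inf_idem]

/-- Cubing is a homeomorphism of the line, so `φ` can be composed with its inverse. -/
theorem exists_pow_three_eq (φ : RL L) : ∃ ρ : RL L, ρ ^ 3 = φ := by
  have hm : StrictMono fun t : ℝ => t ^ 3 := Odd.strictMono_pow (by decide)
  have hs : Function.Surjective fun t : ℝ => t ^ 3 := by
    refine Continuous.surjective (by fun_prop) ?_ ?_
    · exact Filter.tendsto_pow_atTop three_ne_zero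
    · exact (Filter.tendsto_neg_atTop_atBot.comp ((Filter.tendsto_pow_atTop three_ne_zero).comp
        Filter.tendsto_neg_atBot_atTop)).congr fun t => by simp [Odd.neg_pow (by decide : Odd 3)]
  let c : C(ℝ, ℝ) := ⟨(hm.orderIsoOfSurjective _ hs).symm, OrderIso.continuous _⟩
  refine ⟨RL.of φ.toHom c, ?_⟩
  rw [pow_three, RL.of_mul, RL.of_mul]
  conv_rhs => rw [← RL.of_self φ]
  congr 1
  ext t
  have := (hm.orderIsoOfSurjective _ hs).apply_symm_apply t
  exact (pow_three _).symm.trans this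

/-! ### Complemented cozero elements -/

/-- The trace on the punctured line of an open set of the line with `0` made isolated. -/
def puncturedTrace : Opens ({t : ℝ // t ≠ 0} ⊕ Unit) → Opens ℝ := fun W =>
  ⟨Subtype.val '' (Sum.inl ⁻¹' (W : Set ({t : ℝ // t ≠ 0} ⊕ Unit))),
    isOpen_compl_singleton.isOpenMap_subtype_val _ (W.isOpen.preimage continuous_inl)⟩

theorem mem_puncturedTrace {W : Opens ({t : ℝ // t ≠ 0} ⊕ Unit)} {t : ℝ} :
    t ∈ puncturedTrace W ↔ ∃ ht : t ≠ 0, Sum.inl ⟨t, ht⟩ ∈ W := by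
  change t ∈ Subtype.val '' _ ↔ _
  simp

theorem puncturedTrace_le (W : Opens ({t : ℝ // t ≠ 0} ⊕ Unit)) : puncturedTrace W ≤ punctured :=
  fun _ h => (mem_puncturedTrace.1 h).1

theorem puncturedTrace_inf (W W' : Opens ({t : ℝ // t ≠ 0} ⊕ Unit)) :
    puncturedTrace (W ⊓ W') = puncturedTrace W ⊓ puncturedTrace W' := by
  ext t
  simp only [SetLike.mem_coe, mem_puncturedTrace, Opens.mem_inf]
  exact ⟨fun ⟨h, h1, h2⟩ => ⟨⟨h, h1⟩, h, h2⟩, fun ⟨⟨h, h1⟩, _, h2⟩ => ⟨h, h1, h2⟩⟩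

theorem puncturedTrace_top : puncturedTrace ⊤ = punctured := by
  ext t
  simp [mem_puncturedTrace, mem_punctured]

theorem puncturedTrace_sSup (S : Set (Opens ({t : ℝ // t ≠ 0} ⊕ Unit))) :
    puncturedTrace (sSup S) = sSup (puncturedTrace '' S) := by
  ext t
  simp only [SetLike.mem_coe, mem_puncturedTrace, Opens.mem_sSup, Set.exists_mem_image]
  exact ⟨fun ⟨h, W, hW, h'⟩ => ⟨W, hW, h, h'⟩, fun ⟨W, hW, h, h'⟩ => ⟨h, W, hW, h'⟩⟩

/-- If `coz φ` has complement `b`, then `φ` extends to the line with `0` made isolated. -/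
def isolateZero (φ : RL L) (b : L) (h : IsCompl (coz φ) b) :
    FrameHom (Opens ({t : ℝ // t ≠ 0} ⊕ Unit)) L where
  toFun W := φ (puncturedTrace W) ⊔ ⨆ (_ : Sum.inr () ∈ W), b
  map_inf' W W' := by
    have hd : ∀ V : Opens ({t : ℝ // t ≠ 0} ⊕ Unit), φ (puncturedTrace V) ⊓ b = ⊥ := fun V =>
      (h.disjoint.mono_left ((OrderHomClass.mono φ (puncturedTrace_le V)).trans_eq
        (coz_eq_apply_punctured φ).symm)).eq_bot
    have hd' : ∀ V : Opens ({t : ℝ // t ≠ 0} ⊕ Unit), b ⊓ φ (puncturedTrace V) = ⊥ := fun V => by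
      rw [inf_comm, hd]
    rw [puncturedTrace_inf, map_inf]
    by_cases h1 : Sum.inr () ∈ W <;> by_cases h2 : Sum.inr () ∈ W' <;>
      simp [Opens.mem_inf, h1, h2, inf_sup_left, inf_sup_right, hd, hd']
  map_top' := by
    rw [puncturedTrace_top, ← coz_eq_apply_punctured, iSup_pos (Opens.mem_top _), h.sup_eq_top]
  map_sSup' S := by
    rw [puncturedTrace_sSup, map_sSup]
    apply le_antisymm
    · refine sup_le (sSup_le ?_) (iSup_le fun hS => ?_)
      · rintro _ ⟨_, ⟨W, hW, rfl⟩, rfl⟩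
        exact le_sup_left.trans (le_sSup (Set.mem_image_of_mem _ hW))
      · obtain ⟨W, hW, hm⟩ := Opens.mem_sSup.1 hS
        refine le_trans ?_ (le_sSup (Set.mem_image_of_mem _ hW))
        exact le_sup_of_le_right (le_iSup_of_le hm le_rfl)
    · refine sSup_le ?_
      rintro _ ⟨W, hW, rfl⟩
      refine sup_le_sup (le_sSup ⟨_, ⟨W, hW, rfl⟩, rfl⟩) (iSup_le fun hm => ?_)
      exact le_iSup_of_le (Opens.mem_sSup.2 ⟨W, hW, hm⟩) le_rfl

/-- The complement `b` plays the part of the zero set: `φ U` splits into its parts in `coz φ` and in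
`b`, and the latter is all of `b` if `0 ∈ U` and `⊥` otherwise. -/
theorem of_isolateZero (φ : RL L) (b : L) (h : IsCompl (coz φ) b) :
    RL.of (isolateZero φ b h) ⟨Sum.elim Subtype.val 0, by fun_prop⟩ = φ := by
  refine DFunLike.ext (F := FrameHom (Opens ℝ) L) _ _ fun U => ?_
  change φ (puncturedTrace (Opens.comap _ U)) ⊔ (⨆ (_ : (0 : ℝ) ∈ U), b) = φ U
  have ht : puncturedTrace (Opens.comap ⟨Sum.elim Subtype.val 0, by fun_prop⟩ U) =
      U ⊓ punctured := by
    ext t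
    simp only [SetLike.mem_coe, mem_puncturedTrace, Opens.mem_inf, mem_punctured]
    exact ⟨fun ⟨h, h'⟩ => ⟨h', h⟩, fun ⟨h', h⟩ => ⟨h, h'⟩⟩
  rw [ht, map_inf, ← coz_eq_apply_punctured]
  have hU : φ U ⊓ coz φ ⊔ φ U ⊓ b = φ U := by
    rw [← inf_sup_left, h.sup_eq_top, inf_top_eq]
  conv_rhs => rw [← hU]
  congr 1
  by_cases h0 : (0 : ℝ) ∈ U
  · rw [iSup_pos h0, eq_comm, inf_eq_right]
    have hs : U ⊔ punctured = ⊤ := by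
      ext x
      simp only [Opens.coe_sup, Set.mem_union, SetLike.mem_coe, mem_punctured, Opens.coe_top,
        Set.mem_univ, iff_true]
      by_cases hx : x = 0
      · exact Or.inl (hx ▸ h0)
      · exact Or.inr hx
    have h' := congrArg φ hs
    rw [map_sup, map_top, ← coz_eq_apply_punctured] at h'
    calc b = b ⊓ (φ U ⊔ coz φ) := by rw [h', inf_top_eq]
      _ = b ⊓ φ U := by rw [inf_sup_left, h.symm.inf_eq_bot, sup_bot_eq]
      _ ≤ φ U := inf_le_right
  · rw [iSup_neg h0, eq_comm, ← le_bot_iff, ← h.inf_eq_bot, coz_eq_apply_punctured]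
    refine inf_le_inf_right _ (OrderHomClass.mono φ fun x hx => mem_punctured.2 ?_)
    rintro rfl
    exact h0 hx

/-- The von Neumann regular elements. -/
def IsVNR {R : Type*} [CommRing R] (x : R) : Prop := ∃ k, x = x ^ 2 * k

/-- Once `0` is isolated, the inverse extended by `0` is continuous and serves as quasi-inverse.
Conversely, a quasi-inverse `k` makes `φ * k` idempotent, and `1 - φ * k` supplies the complement.
-/
theorem isComplemented_coz_iff {φ : RL L} : IsComplemented (coz φ) ↔ IsVNR φ := by
  constructor
  · rintro ⟨b, h⟩
    have hinv : Continuous (Sum.elim (fun t => (t.1)⁻¹) 0 : {t : ℝ // t ≠ 0} ⊕ Unit → ℝ) := by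
      refine Continuous.sumElim ?_ continuous_const
      exact continuous_subtype_val.inv₀ fun t => t.2
    obtain ⟨δ, rfl⟩ : ∃ δ : FrameHom (Opens ({t : ℝ // t ≠ 0} ⊕ Unit)) L,
        RL.of δ ⟨Sum.elim Subtype.val 0, by fun_prop⟩ = φ := ⟨_, of_isolateZero φ b h⟩
    refine ⟨RL.of δ ⟨_, hinv⟩, ?_⟩
    rw [pow_two, RL.of_mul, RL.of_mul]
    congr 1
    ext z
    rcases z with ⟨t, ht⟩ | _
    · simp [mul_assoc, ht]
    · simp
  · rintro ⟨k, hk⟩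
    refine ⟨coz (1 - φ * k), IsCompl.of_eq ?_ ?_⟩
    · rw [coz_mul_eq_bot_iff, mul_sub, mul_one, ← mul_assoc, ← pow_two, ← hk, sub_self]
    · rw [← top_le_iff, ← coz_one]
      calc coz (1 : RL L) = coz (φ * k + (1 - φ * k)) := by rw [add_sub_cancel]
        _ ≤ coz (φ * k) ⊔ coz (1 - φ * k) := coz_add_le _ _
        _ ≤ _ := sup_le_sup_right ((coz_mul φ k).trans_le inf_le_left) _

end CozeroCalculus

/-! ### Comparing two functions, and splitting a cozero element -/

section Comparison

/-- The function `(x, y) ↦ x³ y / max (x², y²)`, which is `x³ / y` where `|x| ≤ |y|`. -/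
def cubeQuot : C(ℝ × ℝ, ℝ) where
  toFun z := z.1 ^ 3 * z.2 / max (z.1 ^ 2) (z.2 ^ 2)
  continuous_toFun := by
    rw [continuous_iff_continuousAt]
    intro z
    by_cases hz : max (z.1 ^ 2) (z.2 ^ 2) = 0
    · have h1 : z.1 = 0 := pow_eq_zero_iff two_ne_zero |>.1
        (le_antisymm (hz ▸ le_max_left _ _) (sq_nonneg _))
      have h2 : z.2 = 0 := pow_eq_zero_iff two_ne_zero |>.1
        (le_antisymm (hz ▸ le_max_right _ _) (sq_nonneg _))
      have h0 : z.1 ^ 3 * z.2 / max (z.1 ^ 2) (z.2 ^ 2) = 0 := by rw [hz, div_zero]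
      rw [ContinuousAt, h0]
      -- With `m = max (x², y²)`, the numerator satisfies `|x³ y| ≤ m²`, so the quotient is at most
      -- `m`, which tends to zero at the origin.
      refine squeeze_zero_norm (a := fun w : ℝ × ℝ => max (w.1 ^ 2) (w.2 ^ 2)) (fun w => ?_) ?_
      · have hm : 0 ≤ max (w.1 ^ 2) (w.2 ^ 2) := le_max_of_le_left (sq_nonneg _)
        rw [Real.norm_eq_abs, abs_div, abs_of_nonneg hm]
        refine div_le_of_le_mul₀ hm hm ?_
        refine abs_le_of_sq_le_sq ?_ (mul_nonneg hm hm)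
        calc (w.1 ^ 3 * w.2) ^ 2 = w.1 ^ 2 * w.1 ^ 2 * (w.1 ^ 2 * w.2 ^ 2) := by ring
          _ ≤ (max (w.1 ^ 2) (w.2 ^ 2) * max (w.1 ^ 2) (w.2 ^ 2)) *
              (max (w.1 ^ 2) (w.2 ^ 2) * max (w.1 ^ 2) (w.2 ^ 2)) := by
            gcongr <;> first | exact le_max_left _ _ | exact le_max_right _ _
          _ = _ := by ring
      · have hc : Continuous fun w : ℝ × ℝ => max (w.1 ^ 2) (w.2 ^ 2) := by fun_prop
        simpa [hz] using hc.tendsto z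
    · exact ContinuousAt.div (by fun_prop) (by fun_prop) hz

theorem mul_cubeQuot {z : ℝ × ℝ} (h : z.1 ^ 2 ≤ z.2 ^ 2) : z.2 * cubeQuot z = z.1 ^ 3 := by
  change z.2 * (z.1 ^ 3 * z.2 / max (z.1 ^ 2) (z.2 ^ 2)) = _
  rw [max_eq_right h]
  by_cases hz : z.2 = 0
  · have : z.1 = 0 := by
      rw [hz] at h
      exact pow_eq_zero_iff two_ne_zero |>.1 (le_antisymm (by simpa using h) (sq_nonneg _))
    simp [hz, this]
  · field_simp

variable {L : Type*} [Order.Frame L]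

/-- Either of two functions divides the cube of the other one off the cozero element of a
function, and these two functions have product zero. -/
theorem exists_cube_eq_mul (α β : RL L) : ∃ ν ξ κ l : RL L, ν * ξ = 0 ∧
    coz (α ^ 3 - β * κ) ≤ coz ν ∧ coz (β ^ 3 - α * l) ≤ coz ξ := by
  obtain ⟨δ, hα, hβ⟩ := RL.exists_of_two α β
  -- The positive and negative parts of `α² - β²`. Where the first vanishes, `α² ≤ β²` and the
  -- division of `α³` by `β` is exact; the second is its mirror image.
  let f : C(ℝ × ℝ, ℝ) := ⟨fun z => max (z.1 ^ 2 - z.2 ^ 2) 0, by fun_prop⟩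
  let g : C(ℝ × ℝ, ℝ) := ⟨fun z => max (z.2 ^ 2 - z.1 ^ 2) 0, by fun_prop⟩
  refine ⟨RL.of δ f, RL.of δ g, RL.of δ cubeQuot,
    RL.of δ (cubeQuot.comp ⟨Prod.swap, by fun_prop⟩), ?_, ?_, ?_⟩
  · rw [RL.of_mul, RL.zero_eq_of δ]
    congr 1
    ext z
    change max (z.1 ^ 2 - z.2 ^ 2) 0 * max (z.2 ^ 2 - z.1 ^ 2) 0 = 0
    rcases le_total (z.1 ^ 2) (z.2 ^ 2) with h | h
    · rw [max_eq_right (sub_nonpos.2 h), zero_mul]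
    · rw [max_eq_right (sub_nonpos.2 h), mul_zero]
  · rw [hα, hβ, pow_three, sub_eq_add_neg, RL.of_mul, RL.of_mul, RL.of_mul, RL.of_neg, RL.of_add]
    refine coz_of_le δ fun z hz => ?_
    contrapose! hz
    change max (z.1 ^ 2 - z.2 ^ 2) 0 = 0 at hz
    change z.1 * (z.1 * z.1) + -(z.2 * cubeQuot z) = 0
    rw [mul_cubeQuot (sub_nonpos.1 (max_eq_right_iff.1 hz))]
    ring
  · rw [hα, hβ, pow_three, sub_eq_add_neg, RL.of_mul, RL.of_mul, RL.of_mul, RL.of_neg, RL.of_add]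
    refine coz_of_le δ fun z hz => ?_
    contrapose! hz
    change max (z.2 ^ 2 - z.1 ^ 2) 0 = 0 at hz
    change z.2 * (z.2 * z.2) + -(z.swap.2 * cubeQuot z.swap) = 0
    rw [mul_cubeQuot (z := z.swap) (sub_nonpos.1 (max_eq_right_iff.1 hz)), Prod.fst_swap]
    ring

/-- Below a cozero element that is not complemented there are two disjoint non-zero cozero
elements. -/
theorem exists_disjoint_of_not_isComplemented {α : RL L} (h : ¬ IsComplemented (coz α)) :
    ∃ β γ : RL L, β ≠ 0 ∧ γ ≠ 0 ∧ β * γ = 0 ∧ coz β ≤ coz α ∧ coz γ ≤ coz α := by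
  -- `f r` is supported on `|t| > |r|` and `g r` on `0 < |t| < |r|`, so composing with `α` gives
  -- disjoint functions below `coz α`. If the lemma fails, one of the two is zero for each `r`.
  let f : ℝ → C(ℝ, ℝ) := fun r => ⟨fun t => max (|t| - |r|) 0, by fun_prop⟩
  let g : ℝ → C(ℝ, ℝ) := fun r => ⟨fun t => t * max (|r| - |t|) 0, by fun_prop⟩
  by_contra! hc
  have key : ∀ r : ℝ, RL.of α.toHom (f r) = 0 ∨ RL.of α.toHom (g r) = 0 := by
    intro r
    by_contra! hr
    refine hc _ _ hr.1 hr.2 ?_ ?_ ?_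
    · rw [RL.of_mul, RL.zero_eq_of α.toHom]
      congr 1
      ext t
      change max (|t| - |r|) 0 * (t * max (|r| - |t|) 0) = 0
      rcases le_total |t| |r| with h | h
      · rw [max_eq_right (sub_nonpos.2 h), zero_mul]
      · rw [max_eq_right (sub_nonpos.2 h), mul_zero, mul_zero]
    · conv_rhs => rw [← RL.of_self α]
      refine coz_of_le _ fun t ht => ?_
      rintro rfl
      refine ht ?_
      change max (|(0 : ℝ)| - |r|) 0 = 0
      simp
    · conv_rhs => rw [← RL.of_self α]
      refine coz_of_le _ fun t ht => ?_
      exact left_ne_zero_of_mul ht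
  -- If some `g r` vanishes, `α` has a gap around zero and `|t| < r` gives the complement. Otherwise
  -- every `f r` with `r > 0` vanishes, and `coz α`, the join of their cozero elements, is `⊥`.
  by_cases hr : ∃ r : ℝ, 0 < r ∧ RL.of α.toHom (g r) = 0
  · obtain ⟨r, hr, h0⟩ := hr
    rw [← coz_eq_bot_iff, coz_of] at h0
    let U : Opens ℝ := ⟨{t | |t| < r}, isOpen_lt (by fun_prop) (by fun_prop)⟩
    refine h ⟨α U, IsCompl.of_eq ?_ ?_⟩
    · rw [coz_eq_apply_punctured, ← map_inf, ← le_bot_iff, ← h0]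
      refine OrderHomClass.mono α.toHom fun t ht => ?_
      have h1 : t ≠ 0 := ht.1
      have h2 : |t| < r := ht.2
      change t * max (|r| - |t|) 0 ≠ 0
      refine mul_ne_zero h1 (ne_of_gt (lt_max_of_lt_left ?_))
      rw [abs_of_pos hr]
      exact sub_pos.2 h2
    · rw [coz_eq_apply_punctured, ← map_sup, ← map_top α]
      congr 1
      ext t
      simp only [Opens.coe_sup, Set.mem_union, SetLike.mem_coe, mem_punctured, Opens.coe_top,
        Set.mem_univ, iff_true]
      by_cases ht : t = 0
      · right
        change |t| < r
        rwa [ht, abs_zero]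
      · exact Or.inl ht
  · push Not at hr
    have h0 : coz α = ⊥ := by
      have hU : punctured = ⨆ r : Set.Ioi (0 : ℝ), Opens.comap (f r) punctured := by
        ext t
        simp only [SetLike.mem_coe, mem_punctured, Opens.mem_iSup]
        constructor
        · intro ht
          refine ⟨⟨|t| / 2, half_pos (abs_pos.2 ht)⟩, ?_⟩
          change max (|t| - |(|t| / 2)|) 0 ≠ 0
          refine ne_of_gt (lt_max_of_lt_left ?_)
          rw [abs_of_pos (half_pos (abs_pos.2 ht)), sub_half]
          exact half_pos (abs_pos.2 ht)
        · rintro ⟨r, hr⟩ rfl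
          refine hr ?_
          change max (|(0 : ℝ)| - |(r : ℝ)|) 0 = 0
          simp
      rw [coz_eq_apply_punctured, hU, map_iSup, iSup_eq_bot]
      intro r
      have := (key r).resolve_right (hr r r.2)
      rwa [← coz_eq_bot_iff, coz_of] at this
    exact h (h0 ▸ isComplemented_bot)

end Comparison

/-! ### Von Neumann regular elements and near idempotents -/

section VonNeumannRegular

variable {R : Type*} [CommRing R]

theorem IsVNR.add {x y : R} (hx : IsVNR x) (hy : IsVNR y) (h : x * y = 0) : IsVNR (x + y) := by
  obtain ⟨k, hk⟩ := hx
  obtain ⟨l, hl⟩ := hy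
  -- The quasi-inverses `k` and `l` are replaced by multiples of `x` and `y`, so that the cross
  -- terms die by `x * y = 0`.
  refine ⟨x * k ^ 2 + y * l ^ 2, ?_⟩
  linear_combination (1 + x * k) * hk + (1 + y * l) * hl -
    (2 * (x * k ^ 2 + y * l ^ 2) + y * k ^ 2 + x * l ^ 2) * h

/-- The idempotents `e` such that all multiples of `1 - e` are von Neumann regular. -/
structure IsNear (e : R) : Prop where
  idem : IsIdempotentElem e
  vnr : ∀ x : R, IsVNR (x * (1 - e))

theorem isNear_one : IsNear (1 : R) := ⟨.one, fun x => ⟨0, by simp⟩⟩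

/-- The complement of `e * f` splits orthogonally as `1 - e` plus `e * (1 - f)`, so `IsVNR.add`
applies. -/
theorem IsNear.mul {e f : R} (he : IsNear e) (hf : IsNear f) : IsNear (e * f) := by
  refine ⟨he.idem.mul hf.idem, fun x => ?_⟩
  have h : x * (1 - e * f) = x * (1 - e) + (x * e) * (1 - f) := by ring
  rw [h]
  refine (he.vnr x).add (hf.vnr _) ?_
  have he' : e * e = e := he.idem
  linear_combination -(x ^ 2 * (1 - f)) * he'

/-- The elements that lie in `I` up to multiplication by a near idempotent. -/
def nearIdeal (I : Ideal R) : Ideal R where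
  carrier := {x | ∃ e, IsNear e ∧ x * e ∈ I}
  add_mem' := by
    rintro x y ⟨e, he, hx⟩ ⟨f, hf, hy⟩
    refine ⟨e * f, he.mul hf, ?_⟩
    have : (x + y) * (e * f) = f * (x * e) + e * (y * f) := by ring
    rw [this]
    exact I.add_mem (I.mul_mem_left _ hx) (I.mul_mem_left _ hy)
  zero_mem' := ⟨1, isNear_one, by simp⟩
  smul_mem' := by
    rintro c x ⟨e, he, hx⟩
    refine ⟨e, he, ?_⟩
    rw [smul_eq_mul, mul_assoc]
    exact I.mul_mem_left _ hx

theorem le_nearIdeal (I : Ideal R) : I ≤ nearIdeal I := fun x hx => ⟨1, isNear_one, by simpa⟩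

/-- The annihilator of an element. -/
def ann (a : R) : Ideal R := LinearMap.ker (LinearMap.mulRight R a)

theorem mem_ann {a x : R} : x ∈ ann a ↔ x * a = 0 := by simp [ann]

end VonNeumannRegular

/-! ### `z_r`-ideals up to near idempotents -/

section Ideals

variable {L : Type*} [Order.Frame L]

/-- An ideal that agrees with a `z_r`-ideal up to near idempotents is a `z_r`-ideal. -/
theorem IsZrIdeal.of_nearIdeal {I J : Ideal (RL L)} (hJ : IsZrIdeal J) (h1 : I ≤ nearIdeal J)
    (h2 : J ≤ nearIdeal I) : IsZrIdeal I := by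
  constructor
  · intro α φ hφ hc
    obtain ⟨e, he, hφe⟩ := h1 hφ
    have hαe : α * e ∈ J := hJ.1 _ _ hφe (by rw [coz_mul, coz_mul, hc])
    obtain ⟨f, hf, hαf⟩ := h2 hαe
    obtain ⟨k, hk⟩ := (he.mul hf).vnr φ
    set x := φ * (1 - e * f) with hx
    -- The idempotent `x * k` is the identity on `coz x`, which equals the cozero element of `α * (1
    -- - e * f)`. So this part of `α` is a multiple of `φ`.
    have hy : α * (1 - e * f) * (1 - x * k) = 0 := by
      rw [← coz_mul_eq_bot_iff, coz_mul, hc, ← coz_mul, ← hx, coz_mul_eq_bot_iff]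
      linear_combination hk
    have : α = α * e * f + α * (1 - e * f) * k * (1 - e * f) * φ := by
      rw [hx] at hy
      linear_combination hy
    rw [this]
    exact I.add_mem hαf (I.mul_mem_left _ hφ)
  · intro α ψ hψ hαψ
    obtain ⟨e, he, hφe⟩ := h1 hαψ
    have hαe : α * e ∈ J := hJ.2 _ _ hψ (by rwa [mul_right_comm])
    obtain ⟨f, hf, hαf⟩ := h2 hαe
    obtain ⟨k, hk⟩ := (he.mul hf).vnr ψ
    -- A regular element that is von Neumann regular on `1 - e * f` is invertible there, so that
    -- part of `α` is a multiple of `α * ψ`.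
    have hz : (1 - e * f) * (1 - ψ * (1 - e * f) * k) = 0 := by
      refine hψ.left ?_
      change ψ * _ = ψ * 0
      linear_combination hk
    have : α = α * e * f + (1 - e * f) * (1 - e * f) * k * (α * ψ) := by
      linear_combination α * hz
    rw [this]
    exact I.add_mem hαf (I.mul_mem_left _ hαψ)

theorem IsPFFrame.isVNR_or (h : IsPFFrame L) {α β : RL L} (hαβ : α * β = 0) :
    IsVNR α ∨ IsVNR β := by
  rw [← isComplemented_coz_iff, ← isComplemented_coz_iff]
  exact h _ ⟨α, rfl⟩ _ ⟨β, rfl⟩ (coz_mul_eq_bot_iff.2 hαβ)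

/-- Otherwise `e` and `1 - e` would each have a multiple that is not von Neumann regular, and these
two have product zero. -/
theorem IsPFFrame.isNear_or (h : IsPFFrame L) {e : RL L} (he : IsIdempotentElem e) :
    IsNear e ∨ IsNear (1 - e) := by
  by_contra! hc
  obtain ⟨α, hα⟩ : ∃ α, ¬ IsVNR (α * (1 - e)) := by
    by_contra! h'
    exact hc.1 ⟨he, h'⟩
  obtain ⟨β, hβ⟩ : ∃ β, ¬ IsVNR (β * (1 - (1 - e))) := by
    by_contra! h'
    exact hc.2 ⟨he.one_sub, h'⟩
  have he' : e * e = e := he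
  rcases h.isVNR_or (α := α * (1 - e)) (β := β * (1 - (1 - e)))
    (by linear_combination -(α * β) * he') with h | h
  · exact hα h
  · exact hβ h

/-- If `ν` is von Neumann regular with quasi-inverse `k`, the idempotent `ν * k` kills `ξ` and its
complement kills `ν`; one of the two is near. -/
theorem IsPFFrame.exists_isNear (h : IsPFFrame L) {ν ξ : RL L} (hνξ : ν * ξ = 0) :
    ∃ e, IsNear e ∧ (ν * e = 0 ∨ ξ * e = 0) := by
  have aux : ∀ ν ξ : RL L, ν * ξ = 0 → IsVNR ν → ∃ e, IsNear e ∧ (ν * e = 0 ∨ ξ * e = 0) := by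
    rintro ν ξ hνξ ⟨k, hk⟩
    have he : IsIdempotentElem (ν * k) := by
      change ν * k * (ν * k) = ν * k
      linear_combination -k * hk
    rcases h.isNear_or he with h | h
    · exact ⟨_, h, Or.inr (by linear_combination k * hνξ)⟩
    · exact ⟨_, h, Or.inl (by linear_combination hk)⟩
  rcases h.isVNR_or hνξ with h' | h'
  · exact aux ν ξ hνξ h'
  · obtain ⟨e, he, h''⟩ := aux ξ ν (by rwa [mul_comm]) h'
    exact ⟨e, he, h''.symm⟩

/-- Of two functions on a `P_F`-frame, one divides the cube of the other one up to a near
idempotent. -/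
theorem IsPFFrame.exists_cube_eq_mul (h : IsPFFrame L) (α β : RL L) :
    ∃ e κ, IsNear e ∧ (α ^ 3 * e = β * κ * e ∨ β ^ 3 * e = α * κ * e) := by
  obtain ⟨ν, ξ, κ, l, hνξ, h1, h2⟩ := PFFrame.exists_cube_eq_mul α β
  have aux : ∀ {x ν e : RL L}, coz x ≤ coz ν → ν * e = 0 → x * e = 0 := fun h h' =>
    coz_mul_eq_bot_iff.1 (le_bot_iff.1 ((inf_le_inf_right _ h).trans_eq (coz_mul_eq_bot_iff.2 h')))
  obtain ⟨e, he, h' | h'⟩ := h.exists_isNear hνξ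
  · exact ⟨e, κ, he, Or.inl (by linear_combination aux h1 h')⟩
  · exact ⟨e, l, he, Or.inr (by linear_combination aux h2 h')⟩

/-- The divisibility puts `coz (α * e)` below `coz β`, so multiplying `α * e` by `β` does not change
its cozero element. -/
theorem IsZIdeal.mul_mem_of_cube {K : Ideal (RL L)} (hK : IsZIdeal K) {α β κ e : RL L}
    (hαβ : α * β ∈ K) (h : α ^ 3 * e = β * κ * e) : α * e ∈ K := by
  refine hK _ (e * (α * β)) (K.mul_mem_left _ hαβ) ?_
  have h1 : coz (α * e) ≤ coz β := by
    rw [coz_mul, ← coz_pow_three, ← coz_mul, h, mul_assoc, coz_mul]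
    exact inf_le_left
  rw [show e * (α * β) = α * e * β by ring, coz_mul (α * e), inf_eq_left.2 h1]

/-- If the products of elements of `I` and `J` lie in the `z`-ideals `I'` and `J'`, then, up to
near idempotents, `I` lies in `J'` or `J` lies in `I'`. -/
theorem IsPFFrame.le_nearIdeal_or (h : IsPFFrame L) {I J I' J' : Ideal (RL L)}
    (hI : IsZIdeal I') (hJ : IsZIdeal J') (hIJ : ∀ α ∈ I, ∀ β ∈ J, α * β ∈ I' ⊓ J') :
    I ≤ nearIdeal J' ∨ J ≤ nearIdeal I' := by
  by_contra! hc
  obtain ⟨α, hα, hα'⟩ := SetLike.not_le_iff_exists.1 hc.1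
  obtain ⟨β, hβ, hβ'⟩ := SetLike.not_le_iff_exists.1 hc.2
  obtain ⟨e, κ, he, h' | h'⟩ := h.exists_cube_eq_mul α β
  · exact hα' ⟨e, he, hJ.mul_mem_of_cube (hIJ α hα β hβ).2 h'⟩
  · refine hβ' ⟨e, he, hI.mul_mem_of_cube (β := α) ?_ h'⟩
    rw [mul_comm]
    exact (hIJ α hα β hβ).1

theorem IsPFFrame.isZrIdeal_or_of_inf (h : IsPFFrame L) {I J : Ideal (RL L)}
    (hIJ : IsZrIdeal (I ⊓ J)) : IsZrIdeal I ∨ IsZrIdeal J := by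
  have hm : ∀ α ∈ I, ∀ β ∈ J, α * β ∈ (I ⊓ J) ⊓ (I ⊓ J) := fun α hα β hβ => by
    rw [inf_idem]
    exact ⟨I.mul_mem_right _ hα, J.mul_mem_left _ hβ⟩
  rcases h.le_nearIdeal_or hIJ.1 hIJ.1 hm with h' | h'
  · exact Or.inl (hIJ.of_nearIdeal h' (inf_le_left.trans (le_nearIdeal I)))
  · exact Or.inr (hIJ.of_nearIdeal h' (inf_le_right.trans (le_nearIdeal J)))

theorem IsPFFrame.isZrIdeal_add (h : IsPFFrame L) {I J : Ideal (RL L)}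
    (hI : IsZrIdeal I) (hJ : IsZrIdeal J) : IsZrIdeal (I + J) := by
  have hm : ∀ α ∈ I, ∀ β ∈ J, α * β ∈ I ⊓ J := fun α hα β hβ =>
    ⟨I.mul_mem_right _ hα, J.mul_mem_left _ hβ⟩
  rcases h.le_nearIdeal_or hI.1 hJ.1 hm with h' | h'
  · exact hJ.of_nearIdeal (sup_le h' (le_nearIdeal J)) (le_sup_right.trans (le_nearIdeal _))
  · exact hI.of_nearIdeal (sup_le (le_nearIdeal I) h') (le_sup_left.trans (le_nearIdeal _))

/-- Each element of the sum is the cube of some `α + β`, and if `β` nearly divides `α³` then it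
nearly divides `(α + β)³`. So the sum lies in the union of `nearIdeal I` and `nearIdeal J`, hence in
one of them. -/
theorem IsPFFrame.isZrIdeal_or_of_add (h : IsPFFrame L) {I J : Ideal (RL L)}
    (hIJ : IsZrIdeal (I + J)) : IsZrIdeal I ∨ IsZrIdeal J := by
  have hu : ((I + J : Ideal (RL L)) : Set (RL L)) ⊆ nearIdeal I ∪ nearIdeal J := by
    intro φ hφ
    obtain ⟨ρ, rfl⟩ := exists_pow_three_eq φ
    have hρ : ρ ∈ I + J := hIJ.1 _ _ hφ (coz_pow_three ρ).symm
    obtain ⟨α, hα, β, hβ, rfl⟩ := Submodule.mem_sup.1 hρ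
    obtain ⟨e, κ, he, h' | h'⟩ := h.exists_cube_eq_mul α β
    · refine Or.inr ⟨e, he, ?_⟩
      have : (α + β) ^ 3 * e = (κ + 3 * α ^ 2 + 3 * α * β + β ^ 2) * e * β := by
        linear_combination h'
      rw [this]
      exact J.mul_mem_left _ hβ
    · refine Or.inl ⟨e, he, ?_⟩
      have : (α + β) ^ 3 * e = (κ + 3 * β ^ 2 + 3 * α * β + α ^ 2) * e * α := by
        linear_combination h'
      rw [this]
      exact I.mul_mem_left _ hα
  rcases Ideal.subset_union.1 hu with h' | h'
  · exact Or.inl (hIJ.of_nearIdeal (le_sup_left.trans (le_nearIdeal _)) h')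
  · exact Or.inr (hIJ.of_nearIdeal (le_sup_right.trans (le_nearIdeal _)) h')

/-! ### Ideals of frames that are not `P_F`-frames -/

theorem isZrIdeal_bot : IsZrIdeal (⊥ : Ideal (RL L)) := by
  constructor
  · intro α φ hφ hc
    rw [Submodule.mem_bot] at hφ ⊢
    rw [← coz_eq_bot_iff, hc, hφ, coz_zero]
  · intro α φ hφ h
    rw [Submodule.mem_bot] at h ⊢
    exact hφ.right (by simpa using h)

theorem isZrIdeal_ann (α : RL L) : IsZrIdeal (ann α) := by
  constructor
  · intro β φ hφ hc
    rw [mem_ann, ← coz_mul_eq_bot_iff] at hφ ⊢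
    rw [hc, hφ]
  · intro β φ hφ h
    rw [mem_ann] at h ⊢
    refine hφ.left ?_
    change φ * (β * α) = φ * 0
    linear_combination h

/-- An ideal that consists of multiples of `α` modulo the annihilator of `α` does not contain the
cube root of `α` unless `α` is von Neumann regular. -/
theorem not_isZrIdeal_span_sup {α : RL L} (hα : ¬ IsVNR α) {K : Ideal (RL L)} (hK : K ≤ ann α) :
    ¬ IsZrIdeal (Ideal.span {α} ⊔ K) := by
  intro h
  obtain ⟨ρ, rfl⟩ := exists_pow_three_eq α
  have hρ : ρ ∈ Ideal.span {ρ ^ 3} ⊔ K :=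
    h.1 _ _ (Ideal.mem_sup_left (Ideal.mem_span_singleton_self _)) (coz_pow_three ρ).symm
  obtain ⟨x, hx, y, hy, hxy⟩ := Submodule.mem_sup.1 hρ
  obtain ⟨k, rfl⟩ := Ideal.mem_span_singleton.1 hx
  have hy' := mem_ann.1 (hK hy)
  -- Cubing `ρ = ρ³ k` gives `ρ³ = (ρ³)² (ρ³ k³)`.
  refine hα ⟨ρ ^ 3 * k ^ 3, ?_⟩
  -- The factor `ρ³` coming from the annihilator is cancelled because `ρ³` and `ρ` have the same
  -- cozero element.
  have hz : ρ * (1 - ρ ^ 2 * k) = 0 := by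
    have h1 : ρ ^ 3 * (ρ * (1 - ρ ^ 2 * k)) = 0 := by
      linear_combination hy' - ρ ^ 3 * hxy
    rwa [← coz_mul_eq_bot_iff, coz_pow_three, coz_mul, inf_left_idem, coz_mul_eq_bot_iff] at h1
  linear_combination (ρ ^ 2 + ρ * (ρ ^ 3 * k) + (ρ ^ 3 * k) ^ 2) * hz

/-- Makes room below `coz α` for a non-zero `δ` disjoint from a `β` that is still not von Neumann
regular. Of two disjoint non-zero pieces, if `γ` is not regular it serves as `β`. If it is, it is
cut out of `α`; the rest cannot be regular, since then `coz α` would be a join of two complemented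
elements. -/
theorem exists_not_isVNR_ann {α : RL L} (hα : ¬ IsVNR α) :
    ∃ β δ : RL L, ¬ IsVNR β ∧ δ ≠ 0 ∧ β * δ = 0 ∧ coz β ≤ coz α ∧ coz δ ≤ coz α := by
  obtain ⟨β, γ, hβ, hγ, hβγ, h1, h2⟩ :=
    exists_disjoint_of_not_isComplemented (mt isComplemented_coz_iff.1 hα)
  by_cases hv : IsVNR γ
  · obtain ⟨k, hk⟩ := hv
    refine ⟨α * (1 - γ * k), γ, fun hv => hα ?_, hγ, by linear_combination α * hk,
      by rw [coz_mul]; exact inf_le_left, h2⟩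
    have hs : coz α = coz (α * (1 - γ * k)) ⊔ coz γ := by
      apply le_antisymm
      · calc coz α = coz (α * (1 - γ * k) + γ * (α * k)) := by congr 1; ring
          _ ≤ coz (α * (1 - γ * k)) ⊔ coz (γ * (α * k)) := coz_add_le _ _
          _ ≤ _ := sup_le_sup_left ((coz_mul _ _).trans_le inf_le_left) _
      · exact sup_le ((coz_mul _ _).trans_le inf_le_left) h2
    rw [← isComplemented_coz_iff, hs]
    exact (isComplemented_coz_iff.2 hv).sup (isComplemented_coz_iff.2 ⟨k, hk⟩)
  · exact ⟨γ, β, hv, hβ, by rwa [mul_comm], h2, h1⟩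

/-- Principal ideals of disjoint functions meet in `0`, which is a `z_r`-ideal, while a principal
`z_r`-ideal has a von Neumann regular generator. -/
theorem isPFFrame_of_inf
    (h : ∀ I J : Ideal (RL L), IsZrIdeal (I ⊓ J) → IsZrIdeal I ∨ IsZrIdeal J) : IsPFFrame L := by
  rintro _ ⟨α, rfl⟩ _ ⟨β, rfl⟩ hαβ
  rw [isComplemented_coz_iff, isComplemented_coz_iff]
  by_contra! hc
  have hi : Ideal.span {α} ⊓ Ideal.span {β} = ⊥ := by
    rw [eq_bot_iff]
    rintro x ⟨hx, hy⟩
    obtain ⟨k, rfl⟩ := Ideal.mem_span_singleton.1 hx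
    obtain ⟨l, hl⟩ := Ideal.mem_span_singleton.1 hy
    rw [Submodule.mem_bot, ← coz_eq_bot_iff, ← le_bot_iff, ← hαβ]
    refine le_inf ((coz_mul _ _).trans_le inf_le_left) ?_
    rw [hl]
    exact (coz_mul _ _).trans_le inf_le_left
  rcases h _ _ (hi.symm ▸ isZrIdeal_bot) with h' | h'
  · exact not_isZrIdeal_span_sup hc.1 bot_le (by rwa [sup_bot_eq])
  · exact not_isZrIdeal_span_sup hc.2 bot_le (by rwa [sup_bot_eq])

theorem isPFFrame_of_add
    (h1 : ∀ I J : Ideal (RL L), IsZrIdeal I → IsZrIdeal J → IsZrIdeal (I + J) ∨ I + J = ⊤)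
    (h2 : ∀ I J : Ideal (RL L), I + J ≠ ⊤ → IsZrIdeal (I + J) → IsZrIdeal I ∨ IsZrIdeal J) :
    IsPFFrame L := by
  -- a proper `z_r`-ideal inside `ann α + ann β` cannot contain both `α` and `β`
  have key : ∀ {α β : RL L} (K : Ideal (RL L)), ¬ IsVNR α → ¬ IsVNR β → K ≠ ⊤ → IsZrIdeal K →
      α ∈ K → β ∈ K → K ≤ K ⊓ ann α + K ⊓ ann β → False := by
    intro α β K hα hβ hK hzr hαK hβK hle
    -- Both summands have the form excluded by `not_isZrIdeal_span_sup`, yet their sum is `K`.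
    have hs : (Ideal.span {α} ⊔ K ⊓ ann α) + (Ideal.span {β} ⊔ K ⊓ ann β) = K := by
      apply le_antisymm
      · refine sup_le (sup_le ?_ inf_le_left) (sup_le ?_ inf_le_left)
        · rwa [Ideal.span_singleton_le_iff_mem]
        · rwa [Ideal.span_singleton_le_iff_mem]
      · exact hle.trans (sup_le_sup le_sup_right le_sup_right)
    rcases h2 _ _ (hs.symm ▸ hK) (hs.symm ▸ hzr) with h' | h'
    · exact not_isZrIdeal_span_sup hα inf_le_right h'
    · exact not_isZrIdeal_span_sup hβ inf_le_right h'
  rintro _ ⟨α, rfl⟩ _ ⟨β, rfl⟩ hαβ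
  rw [isComplemented_coz_iff, isComplemented_coz_iff]
  by_contra! hc
  obtain ⟨α', δ, hα', hδ, hαδ, hle, hδα⟩ := exists_not_isVNR_ann hc.1
  have hα'β : α' * β = 0 :=
    coz_mul_eq_bot_iff.1 (le_bot_iff.1 ((inf_le_inf_right _ hle).trans_eq hαβ))
  have hβδ : β * δ = 0 := by
    rw [mul_comm]
    exact coz_mul_eq_bot_iff.1 (le_bot_iff.1 ((inf_le_inf_right _ hδα).trans_eq hαβ))
  -- If the sum of annihilators is proper, it serves as `K`, being a `z_r`-ideal by `h1`. If not,
  -- `ann δ` serves: it is proper as `δ ≠ 0`, and writing `1 = y + z` with `y ∈ ann α'` and `z ∈ ann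
  -- β` splits each of its elements.
  by_cases ht : ann α' + ann β = ⊤
  · refine key (ann δ) hα' hc.2 ?_ (isZrIdeal_ann δ) (mem_ann.2 hαδ) (mem_ann.2 hβδ) ?_
    · rw [Ne, Ideal.eq_top_iff_one, mem_ann, one_mul]
      exact hδ
    · intro x hx
      obtain ⟨y, hy, z, hz, hyz⟩ := Submodule.mem_sup.1 ((Ideal.eq_top_iff_one _).1 ht)
      refine Submodule.mem_sup.2 ⟨x * y, ⟨Ideal.mul_mem_right _ _ hx, Ideal.mul_mem_left _ _ hy⟩,
        x * z, ⟨Ideal.mul_mem_right _ _ hx, Ideal.mul_mem_left _ _ hz⟩, ?_⟩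
      rw [← mul_add, hyz, mul_one]
  · refine key (ann α' + ann β) hα' hc.2 ht
      ((h1 _ _ (isZrIdeal_ann _) (isZrIdeal_ann _)).resolve_right ht)
      (Ideal.mem_sup_right (mem_ann.2 hα'β))
      (Ideal.mem_sup_left (mem_ann.2 (by rwa [mul_comm]))) ?_
    rw [inf_eq_right.2 le_sup_left, inf_eq_right.2 le_sup_right]

end Ideals
end PFFrame

end

theorem mainTheorem5 {L : Type*} [Order.Frame L] (hL : PFFrame.IsCompletelyRegular L) :
    List.TFAE [
      (∀ I J : Ideal (PFFrame.RL L), PFFrame.IsZrIdeal I → PFFrame.IsZrIdeal J →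
          PFFrame.IsZrIdeal (I + J) ∨ I + J = ⊤) ∧
        (∀ I J : Ideal (PFFrame.RL L), I + J ≠ ⊤ → PFFrame.IsZrIdeal (I + J) →
          PFFrame.IsZrIdeal I ∨ PFFrame.IsZrIdeal J),
      PFFrame.IsPFFrame L,
      ∀ I J : Ideal (PFFrame.RL L), PFFrame.IsZrIdeal (I ⊓ J) →
        PFFrame.IsZrIdeal I ∨ PFFrame.IsZrIdeal J] := by
  tfae_have 1 → 2 := fun h => PFFrame.isPFFrame_of_add h.1 h.2
  tfae_have 2 → 1 := fun h =>
    ⟨fun _ _ hI hJ => Or.inl (h.isZrIdeal_add hI hJ), fun _ _ _ hIJ => h.isZrIdeal_or_of_add hIJ⟩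
  tfae_have 2 → 3 := fun h _ _ hIJ => h.isZrIdeal_or_of_inf hIJ
  tfae_have 3 → 2 := PFFrame.isPFFrame_of_inf
  tfae_finish
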